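/- Let $X$ be a real Banach space with dual $X^*$ and pairing $\langle\cdot,\cdot\rangle$, and let $A : X \rightrightarrows X^*$ be a maximal monotone operator with graph $\mathrm{Gr}(A)=\{(x,x^*): x^*\in Ax\}$ and range $\mathrm{Im}\,A=\bigcup_{x\in X}Ax$. Let $$F_A(x,x^*)=\sup_{(y,y^*)\in\mathrm{Gr}(A)}\bigl\{\langle y,x^*\rangle+\langle x,y^*\rangle-\langle y,y^*\rangle\bigr\}$$ be its Fitzpatrick function, and let $\mathcal F_A$ be its Fitzpatrick family, i.e. the set of all proper, convex, (norm) lower semicontinuous functions $h:X\times X^*\to\mathbb R\cup\{+\infty\}$ such that $h(x,x^*)\ge\langle x,x^*\rangle$ for all $(x,x^*)\in X\times X^*$, with equality for all $(x,x^*)\in\mathrm{Gr}(A)$. Assume that $\mathcal F_A=\{F_A\}$. Call $A$ $n$-monotone if $\sum_{i=1}^n\langle a_i,a_i^*\rangle\ge\sum_{i=1}^n\langle a_{i+1},a_i^*\rangle$ for all $(a_1,a_1^*),\dots,(a_n,a_n^*)\in\mathrm{Gr}(A)$, where $a_{n+1}=a_1$, and cyclically monotone if it is $n$-monotone for every $n\in\mathbb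 N$. Then $A$ is $3$-monotone if and only if $A$ is cyclically monotone. Moreover, for every $v^*\in\mathrm{Im}\,A$, the function $x\mapsto F_A(x,v^*)$ is proper, convex and lower semicontinuous, and if the above equivalent conditions hold, then $$A=\partial F_A(\cdot,v^*)\quad\text{for every } v^*\in\mathrm{Im}\,A,$$ where $\partial f(x)=\{x^*\in X^*: f(y)\ge f(x)+\langle y-x,x^*\rangle\ \text{for all } y\in X\}$ for $x$ with $f(x)<+\infty$, and $\partial f(x)=\varnothing$ otherwise. -/

import Mathlib

namespace MonotoneOp

variable {X : Type*} [NormedAddCommGroup X] [NormedSpace ℝ X]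

/-- The graph of a set-valued operator `A : X ⇉ X*`. -/
def graph (A : X → Set (StrongDual ℝ X)) : Set (X × StrongDual ℝ X) :=
  {p | p.2 ∈ A p.1}

/-- The range (image) of a set-valued operator. -/
def Im (A : X → Set (StrongDual ℝ X)) : Set (StrongDual ℝ X) :=
  {xs | ∃ x, xs ∈ A x}

/-- `A` is monotone. -/
def IsMonotone (A : X → Set (StrongDual ℝ X)) : Prop :=
  ∀ p ∈ graph A, ∀ q ∈ graph A, p.2 q.1 + q.2 p.1 ≤ p.2 p.1 + q.2 q.1

/-- `A` is maximal monotone: it is monotone and has no strict monotone extension. -/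
def IsMaximalMonotone (A : X → Set (StrongDual ℝ X)) : Prop :=
  IsMonotone A ∧
    ∀ B : X → Set (StrongDual ℝ X), IsMonotone B → graph A ⊆ graph B → B = A

/-- `A` is `n`-monotone. The points are `a 0, …, a (n - 1)`, with the cyclic convention
`a n = a 0`; the values of `a` beyond `n` are irrelevant. -/
def IsNMonotone (n : ℕ) (A : X → Set (StrongDual ℝ X)) : Prop :=
  ∀ a : ℕ → X × StrongDual ℝ X, (∀ i < n, a i ∈ graph A) → a n = a 0 →
    ∑ i ∈ Finset.range n, (a i).2 (a (i + 1)).1 ≤ ∑ i ∈ Finset.range n, (a i).2 (a i).1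

/-- `A` is cyclically monotone. -/
def IsCyclicallyMonotone (A : X → Set (StrongDual ℝ X)) : Prop :=
  ∀ n : ℕ, IsNMonotone n A

/-- An extended-real-valued function is proper: it takes values in `ℝ ∪ {+∞}` and is not
identically `+∞`. -/
def IsProper {E : Type*} (f : E → EReal) : Prop :=
  (∀ x, f x ≠ ⊥) ∧ ∃ x, f x ≠ ⊤

/-- An extended-real-valued function is convex: its epigraph in `E × ℝ` is convex. -/
def IsConvex {E : Type*} [AddCommGroup E] [Module ℝ E] (f : E → EReal) : Prop :=
  Convex ℝ {p : E × ℝ | f p.1 ≤ (p.2 : EReal)}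

/-- The subdifferential of `f : X → ℝ ∪ {+∞}`; it is empty outside the domain of `f`. -/
def subdifferential (f : X → EReal) (x : X) : Set (StrongDual ℝ X) :=
  {xs | f x ≠ ⊤ ∧ ∀ y, f x + ((xs (y - x) : ℝ) : EReal) ≤ f y}

/-- The Fitzpatrick function
`F_A(x, x*) = sup {⟨y, x*⟩ + ⟨x, y*⟩ - ⟨y, y*⟩ : (y, y*) ∈ Gr A}`. -/
noncomputable def fitzpatrickFunction (A : X → Set (StrongDual ℝ X))
    (p : X × StrongDual ℝ X) : EReal :=
  ⨆ q ∈ graph A, ((p.2 q.1 + q.2 p.1 - q.2 q.1 : ℝ) : EReal)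

/-- `h` is a representative function of `A` (the topology on `X × X*` is the norm topology). -/
structure IsRepresentative (A : X → Set (StrongDual ℝ X))
    (h : X × StrongDual ℝ X → EReal) : Prop where
  proper : IsProper h
  convex : IsConvex h
  lsc : LowerSemicontinuous h
  ge_pairing : ∀ p, ((p.2 p.1 : ℝ) : EReal) ≤ h p
  eq_pairing : ∀ p ∈ graph A, h p = ((p.2 p.1 : ℝ) : EReal)

/-- The Fitzpatrick family of `A`: the set of all its representative functions. -/
def fitzpatrickFamily (A : X → Set (StrongDual ℝ X)) : Set (X × StrongDual ℝ X → EReal) :=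
  {h | IsRepresentative A h}

end MonotoneOp

namespace MonotoneOp

section Convexity

variable {E : Type*} [AddCommGroup E] [Module ℝ E]

/-! The order-three Fitzpatrick function `F₃` always dominates `F_A`, and 3-monotonicity bounds `F₃`
by the pairing on the graph. So `F₃` is a representative, and uniqueness forces `F₃ = F_A`. Freezing
`(b, b*)` in the supremum defining `F₃` leaves `F_A(b, v*) + ⟨x - b, b*⟩ ≤ F₃(x, v*) = F_A(x, v*)`,
which makes `b*` a subgradient of `F_A(·, v*)` at `b`. Thus `A ⊆ ∂F_A(·, v*)`; the right side is
monotone, so maximality gives equality, and subdifferentials are cyclically monotone. -/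

theorem IsConvex.iSup {ι : Sort*} {f : ι → E → EReal} (hf : ∀ i, IsConvex (f i)) :
    IsConvex (fun x => ⨆ i, f i x) := by
  have h : {p : E × ℝ | (⨆ i, f i p.1) ≤ (p.2 : EReal)} =
      ⋂ i, {p : E × ℝ | f i p.1 ≤ (p.2 : EReal)} := by
    ext p; simp [iSup_le_iff]
  unfold IsConvex
  rw [h]
  exact convex_iInter hf

theorem isConvex_coe_of_convexOn {g : E → ℝ} (hg : ConvexOn ℝ Set.univ g) :
    IsConvex (fun x => (g x : EReal)) := by
  simpa [IsConvex] using hg.convex_epigraph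

end Convexity

variable {X : Type*} [NormedAddCommGroup X] [NormedSpace ℝ X]

/-- The Fitzpatrick function of order three,
`F_{A,3}(x, x*) = sup {⟨b - a, a*⟩ + ⟨x - b, b*⟩ + ⟨a, x*⟩ : (a, a*), (b, b*) ∈ Gr A}`. -/
noncomputable def fitzpatrickFunctionThree (A : X → Set (StrongDual ℝ X))
    (p : X × StrongDual ℝ X) : EReal :=
  ⨆ a ∈ graph A, ⨆ b ∈ graph A,
    ((a.2 (b.1 - a.1) + b.2 (p.1 - b.1) + p.2 a.1 : ℝ) : EReal)

theorem convexOn_order_three (a b : X × StrongDual ℝ X) :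
    ConvexOn ℝ Set.univ (fun p : X × StrongDual ℝ X =>
      a.2 (b.1 - a.1) + b.2 (p.1 - b.1) + p.2 a.1) := by
  refine ⟨convex_univ, fun p _ q _ s t _ _ hst => le_of_eq ?_⟩
  obtain rfl : t = 1 - s := by linarith
  simp
  ring

theorem convexOn_fitzpatrick_slice (v : StrongDual ℝ X) (q : X × StrongDual ℝ X) :
    ConvexOn ℝ Set.univ (fun x : X => v q.1 + q.2 x - q.2 q.1) := by
  refine ⟨convex_univ, fun p _ q _ s t _ _ hst => le_of_eq ?_⟩
  obtain rfl : t = 1 - s := by linarith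
  simp
  ring

theorem isConvex_fitzpatrickFunction_slice (A : X → Set (StrongDual ℝ X))
    (v : StrongDual ℝ X) : IsConvex (fun x => fitzpatrickFunction A (x, v)) :=
  IsConvex.iSup fun q => IsConvex.iSup fun _ =>
    isConvex_coe_of_convexOn (convexOn_fitzpatrick_slice v q)

theorem isConvex_fitzpatrickFunctionThree (A : X → Set (StrongDual ℝ X)) :
    IsConvex (fitzpatrickFunctionThree A) :=
  IsConvex.iSup fun a => IsConvex.iSup fun _ => IsConvex.iSup fun b => IsConvex.iSup fun _ =>
    isConvex_coe_of_convexOn (convexOn_order_three a b)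

theorem lowerSemicontinuous_fitzpatrickFunctionThree (A : X → Set (StrongDual ℝ X)) :
    LowerSemicontinuous (fitzpatrickFunctionThree A) := by
  refine lowerSemicontinuous_iSup fun a => lowerSemicontinuous_iSup fun _ =>
    lowerSemicontinuous_iSup fun b => lowerSemicontinuous_iSup fun _ =>
      Continuous.lowerSemicontinuous ?_
  exact continuous_coe_real_ereal.comp (by fun_prop)

/-- Restrict the double supremum to the diagonal `a = b = q`. -/
theorem fitzpatrickFunction_le_three (A : X → Set (StrongDual ℝ X))
    (p : X × StrongDual ℝ X) : fitzpatrickFunction A p ≤ fitzpatrickFunctionThree A p := by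
  refine iSup₂_le fun q hq => ?_
  refine le_trans (EReal.coe_le_coe_iff.2 (le_of_eq ?_))
    (le_iSup₂_of_le q hq (le_iSup₂_of_le q hq le_rfl))
  simp
  ring

theorem IsNMonotone.three_le {A : X → Set (StrongDual ℝ X)} (h3 : IsNMonotone 3 A)
    {a b c : X × StrongDual ℝ X} (ha : a ∈ graph A) (hb : b ∈ graph A) (hc : c ∈ graph A) :
    a.2 b.1 + b.2 c.1 + c.2 a.1 ≤ a.2 a.1 + b.2 b.1 + c.2 c.1 := by
  have h := h3 (fun i => if i = 0 then a else if i = 1 then b else if i = 2 then c else a)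
    (fun i hi => by interval_cases i <;> simpa) (by simp)
  simpa [Finset.sum_range_succ] using h

theorem fitzpatrickFunctionThree_le_pairing {A : X → Set (StrongDual ℝ X)}
    (h3 : IsNMonotone 3 A) {p : X × StrongDual ℝ X} (hp : p ∈ graph A) :
    fitzpatrickFunctionThree A p ≤ ((p.2 p.1 : ℝ) : EReal) := by
  refine iSup₂_le fun a ha => iSup₂_le fun b hb => EReal.coe_le_coe_iff.2 ?_
  have := h3.three_le ha hb hp
  simp only [map_sub]
  linarith

/-- A 3-monotone operator whose Fitzpatrick function is a representative also has the
Fitzpatrick function of order three as a representative. -/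
theorem isRepresentative_fitzpatrickFunctionThree {A : X → Set (StrongDual ℝ X)}
    (hF : IsRepresentative A (fitzpatrickFunction A)) (hne : (graph A).Nonempty)
    (h3 : IsNMonotone 3 A) : IsRepresentative A (fitzpatrickFunctionThree A) where
  proper := by
    refine ⟨fun p hp => ?_, hne.some, ne_top_of_le_ne_top (EReal.coe_ne_top _)
      (fitzpatrickFunctionThree_le_pairing h3 hne.some_mem)⟩
    exact hF.proper.1 p (le_bot_iff.1 (hp ▸ fitzpatrickFunction_le_three A p))
  convex := isConvex_fitzpatrickFunctionThree A
  lsc := lowerSemicontinuous_fitzpatrickFunctionThree A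
  ge_pairing p := (hF.ge_pairing p).trans (fitzpatrickFunction_le_three A p)
  eq_pairing p hp := le_antisymm (fitzpatrickFunctionThree_le_pairing h3 hp)
    ((hF.ge_pairing p).trans (fitzpatrickFunction_le_three A p))

/-- With `b` fixed, the supremum over `a` alone is `F_A(b, v)` plus a constant. This is the source
of the subgradient inequality. -/
theorem fitzpatrickFunction_add_le_three (A : X → Set (StrongDual ℝ X))
    {b : X × StrongDual ℝ X} (hb : b ∈ graph A) (x : X) (v : StrongDual ℝ X) :
    fitzpatrickFunction A (b.1, v) + ((b.2 (x - b.1) : ℝ) : EReal) ≤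
      fitzpatrickFunctionThree A (x, v) := by
  -- The finite term moves to the right so that the supremum can be bounded termwise.
  rw [← EReal.le_sub_iff_add_le (.inl (EReal.coe_ne_bot _)) (.inl (EReal.coe_ne_top _))]
  refine iSup₂_le fun a ha => ?_
  rw [EReal.le_sub_iff_add_le (.inl (EReal.coe_ne_bot _)) (.inl (EReal.coe_ne_top _)),
    ← EReal.coe_add]
  refine le_trans (EReal.coe_le_coe_iff.2 (le_of_eq ?_))
    (le_iSup₂_of_le a ha (le_iSup₂_of_le b hb le_rfl))
  simp
  ring

/-- On the subdifferential of a function without the value `-∞`, the subgradient inequality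
between points of the domain is an inequality of real numbers. -/
theorem apply_sub_le_toReal_sub {f : X → EReal} (hf : ∀ x, f x ≠ ⊥)
    {x y : X} {xs : StrongDual ℝ X} (hx : xs ∈ subdifferential f x) (hy : f y ≠ ⊤) :
    xs y - xs x ≤ (f y).toReal - (f x).toReal := by
  have h := hx.2 y
  rw [← EReal.coe_toReal hx.1 (hf x), ← EReal.coe_toReal hy (hf y), ← EReal.coe_add,
    EReal.coe_le_coe_iff, map_sub] at h
  linarith

/-- The subgradient inequalities along the cycle have a telescoping right-hand side with sum zero.
-/
theorem isCyclicallyMonotone_subdifferential {f : X → EReal} (hf : ∀ x, f x ≠ ⊥) :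
    IsCyclicallyMonotone (subdifferential f) := by
  intro n a ha hn
  have hdom : ∀ i < n, f (a (i + 1)).1 ≠ ⊤ := by
    intro i hi
    -- The last successor `a n` is covered only through `a n = a 0`.
    rcases (Nat.succ_le_of_lt hi).lt_or_eq with h | h
    · exact (ha _ h).1
    · rw [show i + 1 = n from h, hn]
      exact (ha 0 (by omega)).1
  have h := Finset.sum_le_sum fun i (hi : i ∈ Finset.range n) =>
    apply_sub_le_toReal_sub hf (ha i (Finset.mem_range.1 hi)) (hdom i (Finset.mem_range.1 hi))
  rw [Finset.sum_range_sub (fun i => (f (a i).1).toReal), Finset.sum_sub_distrib, hn,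
    sub_self] at h
  exact sub_nonpos.1 h

theorem isMonotone_subdifferential {f : X → EReal} (hf : ∀ x, f x ≠ ⊥) :
    IsMonotone (subdifferential f) := by
  intro p hp q hq
  have h1 := apply_sub_le_toReal_sub hf hp (y := q.1) hq.1
  have h2 := apply_sub_le_toReal_sub hf hq (y := p.1) hp.1
  linarith

/-- If the Fitzpatrick function is the only representative of a 3-monotone operator, then every
`b* ∈ A b` is a subgradient at `b` of each partial function `F_A(·, v*)`, `v* ∈ Im A`. -/
theorem graph_subset_graph_subdifferential {A : X → Set (StrongDual ℝ X)}
    (hF : fitzpatrickFamily A = {fitzpatrickFunction A}) (h3 : IsNMonotone 3 A)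
    {v : StrongDual ℝ X} (hv : v ∈ Im A) :
    graph A ⊆ graph (subdifferential fun x => fitzpatrickFunction A (x, v)) := by
  obtain ⟨u, hu⟩ := hv
  have hu : (u, v) ∈ graph A := hu
  have hrep : IsRepresentative A (fitzpatrickFunction A) :=
    hF.ge (Set.mem_singleton _)
  have heq : fitzpatrickFunctionThree A = fitzpatrickFunction A :=
    hF.le (isRepresentative_fitzpatrickFunctionThree hrep ⟨_, hu⟩ h3)
  have key : ∀ b ∈ graph A, ∀ x, fitzpatrickFunction A (b.1, v) +
      ((b.2 (x - b.1) : ℝ) : EReal) ≤ fitzpatrickFunction A (x, v) := fun b hb x =>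
    heq ▸ fitzpatrickFunction_add_le_three A hb x v
  refine fun b hb => ⟨fun htop => ?_, key b hb⟩
  have htop : fitzpatrickFunction A (b.1, v) = ⊤ := htop
  -- An infinite value at `b` would propagate to `u`, where `F_A(u, v) = ⟨u, v⟩` is finite.
  have h := key b hb u
  rw [htop, EReal.top_add_coe, hrep.eq_pairing _ hu, top_le_iff] at h
  exact EReal.coe_ne_top _ h

theorem eq_subdifferential_fitzpatrickFunction {A : X → Set (StrongDual ℝ X)}
    (hA : IsMaximalMonotone A) (hF : fitzpatrickFamily A = {fitzpatrickFunction A})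
    (h3 : IsNMonotone 3 A) {v : StrongDual ℝ X} (hv : v ∈ Im A) :
    A = subdifferential fun x => fitzpatrickFunction A (x, v) := by
  have hrep : IsRepresentative A (fitzpatrickFunction A) :=
    hF.ge (Set.mem_singleton _)
  exact (hA.2 _ (isMonotone_subdifferential fun x => hrep.proper.1 (x, v))
    (graph_subset_graph_subdifferential hF h3 hv)).symm

end MonotoneOp

theorem theoremA {X : Type*} [NormedAddCommGroup X] [NormedSpace ℝ X] [CompleteSpace X]
    (A : X → Set (StrongDual ℝ X)) (hA : MonotoneOp.IsMaximalMonotone A)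
    (hF : MonotoneOp.fitzpatrickFamily A = {MonotoneOp.fitzpatrickFunction A}) :
    (MonotoneOp.IsNMonotone 3 A ↔ MonotoneOp.IsCyclicallyMonotone A) ∧
    ∀ v ∈ MonotoneOp.Im A,
      MonotoneOp.IsProper (fun x => MonotoneOp.fitzpatrickFunction A (x, v)) ∧
      MonotoneOp.IsConvex (fun x => MonotoneOp.fitzpatrickFunction A (x, v)) ∧
      LowerSemicontinuous (fun x => MonotoneOp.fitzpatrickFunction A (x, v)) ∧
      (MonotoneOp.IsNMonotone 3 A →
        A = MonotoneOp.subdifferential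
          (fun x => MonotoneOp.fitzpatrickFunction A (x, v))) := by
  have hrep : MonotoneOp.IsRepresentative A (MonotoneOp.fitzpatrickFunction A) :=
    hF.ge (Set.mem_singleton _)
  refine ⟨⟨fun h3 n a ha hn => ?_, fun h => h 3⟩, fun v hv => ⟨?_, ?_, ?_, fun h3 => ?_⟩⟩
  · rcases Nat.eq_zero_or_pos n with rfl | h0
    -- The empty cycle is separate: it supplies no graph point from which to take `v*`.
    · simp
    have hv : (a 0).2 ∈ MonotoneOp.Im A := ⟨_, ha 0 h0⟩
    have hcyc := MonotoneOp.isCyclicallyMonotone_subdifferential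
      (f := fun x => MonotoneOp.fitzpatrickFunction A (x, (a 0).2))
      (fun x => hrep.proper.1 _)
    rw [← MonotoneOp.eq_subdifferential_fitzpatrickFunction hA hF h3 hv] at hcyc
    exact hcyc n a ha hn
  · obtain ⟨u, hu⟩ := hv
    refine ⟨fun x => hrep.proper.1 _, u, ?_⟩
    exact (hrep.eq_pairing (u, v) hu).trans_ne (EReal.coe_ne_top _)
  · exact MonotoneOp.isConvex_fitzpatrickFunction_slice A v
  · exact hrep.lsc.comp (by fun_prop : Continuous fun x : X => (x, v))
  · exact MonotoneOp.eq_subdifferential_fitzpatrickFunction hA hF h3 hv
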